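/- Let $k$ be a field, let $Q=(Q_0,Q_1,\mathfrak s,\mathfrak t)$ be a finite quiver, and compose paths from left to right, so that $ab$ is a path when $\mathfrak t(a)=\mathfrak s(b)$ (products of non-composable arrows are $0$ in $kQ$). Let $(Q,I)$ be an almost gentle pair: $I$ is an admissible ideal of the path algebra $kQ$ generated by some paths of length two, and for every arrow $a$ there is at most one arrow $b$ with $\mathfrak s(b)=\mathfrak t(a)$ and $ab\notin I$, and at most one arrow $c$ with $\mathfrak t(c)=\mathfrak s(a)$ and $ca\notin I$. Let $A=kQ/I$ be the corresponding almost gentle algebra, and for a vertex $v$ let $S(v)$ be the corresponding simple right $A$-module (one-dimensional; $e_v$ acts as the identity, all other $e_w$ and all arrows act as zero). A path $a_1\cdots a_n$ of length $n\ge 1$ is called forbidden if $a_ia_{i+1}\in I$ for all $1\le i\le n-1$. The path $e_v$ of length $0$ is called forbidden if one of the following holds: (1) there is a unique arrow $a$ with $\mathfrak t(a)=v$, there is a unique arrow $b$ with $\mathfrak s(b)=v$, and $ab\in I$; (2) $v$ is a source and there is exactly one arrow with source $v$; (3) $v$ is a sink and there is exactly one arrow with target $v$. Let $\mathcal F(v)$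 be the set of all forbidden paths starting at $v$, and let $\ell(F)$ denote the length of $F$. Then for every vertex $v$, $$\operatorname{proj.dim} S(v)=\sup_{F\in\mathcal F(v)}\ell(F)\in\mathbb N\cup\{\infty\},$$ where the supremum is $\infty$ if the lengths are unbounded, and the supremum of the empty set is $0$. -/

import Mathlib

open CategoryTheory

set_option linter.unusedSectionVars false

universe u

noncomputable section

/-! ### The path algebra of a finite quiver -/

section PathAlgebra

variable (k : Type u) [Field k] (V : Type u) [Quiver.{u} V]

/-- The path algebra `kQ` of a quiver `Q` with (finite) vertex type `V`: an element is a
`k`-linear combination of paths, stored as the family, indexed by the pairs `(i, j)` of vertices,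
of its components in the span of the paths from `i` to `j`. -/
def PathAlgebra : Type u := ∀ i j : V, (Quiver.Path i j →₀ k)

namespace PathAlgebra

instance : AddCommGroup (PathAlgebra k V) :=
  inferInstanceAs (AddCommGroup (∀ i j : V, (Quiver.Path i j →₀ k)))

instance : Module k (PathAlgebra k V) :=
  inferInstanceAs (Module k (∀ i j : V, (Quiver.Path i j →₀ k)))

variable {k V}

@[ext]
theorem ext {f g : PathAlgebra k V} (h : ∀ i j, f i j = g i j) : f = g :=
  funext fun i => funext fun j => h i j

@[simp] theorem add_apply (f g : PathAlgebra k V) (i j : V) : (f + g) i j = f i j + g i j := rfl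
@[simp] theorem zero_apply (i j : V) : (0 : PathAlgebra k V) i j = 0 := rfl
@[simp] theorem smul_apply (c : k) (f : PathAlgebra k V) (i j : V) :
    (c • f) i j = c • f i j := rfl

/-- The bilinear extension of the concatenation of paths `i ⟶ l` with paths `l ⟶ j`. -/
def concat {i l j : V} (f : Quiver.Path i l →₀ k) (g : Quiver.Path l j →₀ k) :
    Quiver.Path i j →₀ k :=
  f.sum fun p a => g.sum fun q b => Finsupp.single (p.comp q) (a * b)

section concat

variable {i l m j : V}

theorem concat_add (f : Quiver.Path i l →₀ k) (g g' : Quiver.Path l j →₀ k) :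
    concat f (g + g') = concat f g + concat f g' := by
  unfold concat
  rw [← Finsupp.sum_add]
  congr 1
  funext p a
  rw [Finsupp.sum_add_index'] <;> simp [mul_add]

theorem add_concat (f f' : Quiver.Path i l →₀ k) (g : Quiver.Path l j →₀ k) :
    concat (f + f') g = concat f g + concat f' g := by
  unfold concat
  rw [Finsupp.sum_add_index'] <;> simp [add_mul]

@[simp] theorem zero_concat (g : Quiver.Path l j →₀ k) :
    concat (0 : Quiver.Path i l →₀ k) g = 0 := by
  simp [concat]

@[simp] theorem concat_zero (f : Quiver.Path i l →₀ k) :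
    concat f (0 : Quiver.Path l j →₀ k) = 0 := by
  simp [concat]

@[simp] theorem single_concat_single (p : Quiver.Path i l) (q : Quiver.Path l j) (a b : k) :
    concat (Finsupp.single p a) (Finsupp.single q b) = Finsupp.single (p.comp q) (a * b) := by
  simp [concat]

theorem smul_concat (c : k) (f : Quiver.Path i l →₀ k) (g : Quiver.Path l j →₀ k) :
    concat (c • f) g = c • concat f g := by
  unfold concat
  rw [Finsupp.sum_smul_index] <;> simp [Finsupp.smul_sum, mul_assoc, -Finsupp.single_mul]

theorem concat_smul (c : k) (f : Quiver.Path i l →₀ k) (g : Quiver.Path l j →₀ k) :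
    concat f (c • g) = c • concat f g := by
  unfold concat
  simp_rw [Finsupp.smul_sum]
  congr 1
  funext p a
  rw [Finsupp.sum_smul_index] <;> simp [mul_left_comm, -Finsupp.single_mul]

theorem concat_assoc (f : Quiver.Path i l →₀ k) (g : Quiver.Path l m →₀ k)
    (h : Quiver.Path m j →₀ k) : concat (concat f g) h = concat f (concat g h) := by
  induction f using Finsupp.induction_linear with
  | zero => simp
  | add f₁ f₂ h₁ h₂ => simp only [add_concat, h₁, h₂]
  | single p a =>
    induction g using Finsupp.induction_linear with
    | zero => simp
    | add g₁ g₂ h₁ h₂ => simp only [add_concat, concat_add, h₁, h₂]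
    | single q b =>
      induction h using Finsupp.induction_linear with
      | zero => simp
      | add g₁ g₂ h₁ h₂ => simp only [concat_add, h₁, h₂]
      | single r c => simp [mul_assoc, Quiver.Path.comp_assoc, -Finsupp.single_mul]

theorem nil_concat (f : Quiver.Path i j →₀ k) :
    concat (Finsupp.single Quiver.Path.nil 1) f = f := by
  simp [concat, -Finsupp.single_mul]

theorem concat_nil (f : Quiver.Path i j →₀ k) :
    concat f (Finsupp.single Quiver.Path.nil 1) = f := by
  simp [concat, -Finsupp.single_mul]

theorem sum_concat {ι : Type*} (s : Finset ι) (f : ι → (Quiver.Path i l →₀ k))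
    (g : Quiver.Path l j →₀ k) : concat (∑ x ∈ s, f x) g = ∑ x ∈ s, concat (f x) g := by
  classical
  induction s using Finset.induction_on with
  | empty => simp
  | insert a s ha ih => simp [Finset.sum_insert ha, add_concat, ih]

theorem concat_sum {ι : Type*} (s : Finset ι) (f : Quiver.Path i l →₀ k)
    (g : ι → (Quiver.Path l j →₀ k)) : concat f (∑ x ∈ s, g x) = ∑ x ∈ s, concat f (g x) := by
  classical
  induction s using Finset.induction_on with
  | empty => simp
  | insert a s ha ih => simp [Finset.sum_insert ha, concat_add, ih]

/-- The trivial path is a concatenation of two paths only in the trivial way. -/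
theorem concat_apply_nil (f : Quiver.Path i l →₀ k) (g : Quiver.Path l i →₀ k) (hl : l ≠ i) :
    concat f g Quiver.Path.nil = 0 := by
  induction f using Finsupp.induction_linear with
  | zero => simp
  | add f₁ f₂ h₁ h₂ => simp [add_concat, h₁, h₂]
  | single p a =>
    induction g using Finsupp.induction_linear with
    | zero => simp
    | add g₁ g₂ h₁ h₂ => simp [concat_add, h₁, h₂]
    | single q b =>
      rw [single_concat_single, Finsupp.single_apply_eq_zero]
      intro h
      have h0 := congrArg Quiver.Path.length h
      rw [Quiver.Path.length_comp, Quiver.Path.length_nil] at h0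
      exact absurd (Quiver.Path.eq_of_length_zero p (by omega)).symm hl

theorem concat_apply_nil_self (f g : Quiver.Path i i →₀ k) :
    concat f g Quiver.Path.nil = f Quiver.Path.nil * g Quiver.Path.nil := by
  classical
  induction f using Finsupp.induction_linear with
  | zero => simp
  | add f₁ f₂ h₁ h₂ => simp [add_concat, h₁, h₂, add_mul]
  | single p a =>
    induction g using Finsupp.induction_linear with
    | zero => simp
    | add g₁ g₂ h₁ h₂ => simp [concat_add, h₁, h₂, mul_add]
    | single q b =>
      rw [single_concat_single]
      by_cases hp : p.length = 0
      · obtain rfl := Quiver.Path.eq_nil_of_length_zero p hp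
        by_cases hq : q.length = 0
        · obtain rfl := Quiver.Path.eq_nil_of_length_zero q hq
          simp
        · have hq' : q ≠ Quiver.Path.nil := fun h => hq (by rw [h]; rfl)
          simp [hq']
      · have hp' : p ≠ Quiver.Path.nil := fun h => hp (by rw [h]; rfl)
        have hpq : p.comp q ≠ Quiver.Path.nil := fun h => hp (by
          have h0 := congrArg Quiver.Path.length h
          rw [Quiver.Path.length_comp, Quiver.Path.length_nil] at h0
          omega)
        simp [Finsupp.single_apply, hp', hpq]

end concat

variable [Fintype V] [DecidableEq V]

/-- The basis element of the path algebra given by a path. -/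
def ofPath {i j : V} (p : Quiver.Path i j) : PathAlgebra k V :=
  Pi.single i (Pi.single j (Finsupp.single p 1))

/-- `1 = ∑ e_v`, the sum of all paths of length zero. -/
instance : One (PathAlgebra k V) := ⟨∑ v : V, ofPath (Quiver.Path.nil : Quiver.Path v v)⟩

/-- The product is the bilinear extension of concatenation; the paths `p`, `q` contribute `pq`
(first `p`, then `q`) if `p` ends where `q` starts, and zero otherwise. -/
instance : Mul (PathAlgebra k V) := ⟨fun f g i j => ∑ l : V, concat (f i l) (g l j)⟩

theorem mul_apply (f g : PathAlgebra k V) (i j : V) :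
    (f * g) i j = ∑ l : V, concat (f i l) (g l j) := rfl

theorem ofPath_apply_self {i j : V} (p : Quiver.Path i j) :
    (ofPath p : PathAlgebra k V) i j = Finsupp.single p 1 := by
  simp [ofPath]

theorem ofPath_apply_of_ne_left {i j : V} (p : Quiver.Path i j) {i' j' : V} (h : i' ≠ i) :
    (ofPath p : PathAlgebra k V) i' j' = 0 := by
  simp [ofPath, h]

theorem ofPath_apply_of_ne_right {i j : V} (p : Quiver.Path i j) {i' j' : V} (h : j' ≠ j) :
    (ofPath p : PathAlgebra k V) i' j' = 0 := by
  by_cases hi : i' = i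
  · subst hi
    simp [ofPath, h]
  · exact ofPath_apply_of_ne_left p hi

theorem one_def : (1 : PathAlgebra k V) = ∑ v : V, ofPath (Quiver.Path.nil : Quiver.Path v v) :=
  rfl

theorem sum_apply {ι : Type*} (s : Finset ι) (f : ι → PathAlgebra k V) (i j : V) :
    (∑ x ∈ s, f x) i j = ∑ x ∈ s, f x i j := by
  classical
  induction s using Finset.induction_on with
  | empty => simp
  | insert a s ha ih => simp [Finset.sum_insert ha, ih]

theorem one_apply_self (i : V) :
    (1 : PathAlgebra k V) i i = Finsupp.single Quiver.Path.nil 1 := by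
  rw [one_def, sum_apply, Finset.sum_eq_single i]
  · exact ofPath_apply_self _
  · intro b _ hb
    exact ofPath_apply_of_ne_left _ hb.symm
  · simp

theorem one_apply_of_ne {i j : V} (h : i ≠ j) : (1 : PathAlgebra k V) i j = 0 := by
  rw [one_def, sum_apply]
  refine Finset.sum_eq_zero fun l _ => ?_
  by_cases hl : i = l
  · subst hl
    exact ofPath_apply_of_ne_right _ h.symm
  · exact ofPath_apply_of_ne_left _ hl

instance : Ring (PathAlgebra k V) where
  __ := (inferInstance : AddCommGroup (PathAlgebra k V))
  mul := (· * ·)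
  one := 1
  left_distrib f g h := by
    ext1 i j
    simp [mul_apply, concat_add, Finset.sum_add_distrib]
  right_distrib f g h := by
    ext1 i j
    simp [mul_apply, add_concat, Finset.sum_add_distrib]
  zero_mul f := by
    ext1 i j
    simp [mul_apply]
  mul_zero f := by
    ext1 i j
    simp [mul_apply]
  mul_assoc f g h := by
    ext1 i j
    simp only [mul_apply, sum_concat, concat_sum, concat_assoc]
    exact Finset.sum_comm
  one_mul f := by
    ext1 i j
    rw [mul_apply, Finset.sum_eq_single i]
    · rw [one_apply_self, nil_concat]
    · intro l _ hl
      rw [one_apply_of_ne hl.symm, zero_concat]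
    · simp
  mul_one f := by
    ext1 i j
    rw [mul_apply, Finset.sum_eq_single j]
    · rw [one_apply_self, concat_nil]
    · intro l _ hl
      rw [one_apply_of_ne hl, concat_zero]
    · simp

instance : Algebra k (PathAlgebra k V) :=
  Algebra.ofModule
    (fun c f g => by
      ext1 i j
      simp [mul_apply, smul_concat, Finset.smul_sum])
    (fun c f g => by
      ext1 i j
      simp [mul_apply, concat_smul, Finset.smul_sum])

/-- Composable paths multiply by concatenation. -/
theorem ofPath_mul_ofPath {i l j : V} (p : Quiver.Path i l) (q : Quiver.Path l j) :
    (ofPath p * ofPath q : PathAlgebra k V) = ofPath (p.comp q) := by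
  ext1 i' j'
  rw [mul_apply, Finset.sum_eq_single l]
  · by_cases hi : i' = i
    · subst hi
      by_cases hj : j' = j
      · subst hj
        simp [ofPath_apply_self]
      · rw [ofPath_apply_of_ne_right q hj, ofPath_apply_of_ne_right _ hj, concat_zero]
    · rw [ofPath_apply_of_ne_left p hi, ofPath_apply_of_ne_left _ hi, zero_concat]
  · intro m _ hm
    rw [ofPath_apply_of_ne_right p hm, zero_concat]
  · simp

/-- Paths that are not composable multiply to zero. -/
theorem ofPath_mul_ofPath_of_ne {i l l' j : V} (p : Quiver.Path i l) (q : Quiver.Path l' j)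
    (h : l ≠ l') : (ofPath p * ofPath q : PathAlgebra k V) = 0 := by
  ext1 i' j'
  rw [mul_apply, zero_apply]
  refine Finset.sum_eq_zero fun m _ => ?_
  by_cases hm : m = l
  · subst hm
    rw [ofPath_apply_of_ne_left q h, concat_zero]
  · rw [ofPath_apply_of_ne_right p hm, zero_concat]

variable (k) in
/-- The element of the path algebra given by an arrow. -/
def arrow (a : Quiver.Total V) : PathAlgebra k V := ofPath a.hom.toPath

variable (k) in
/-- The coefficient at `e_v`. It is the algebra character `kQ → k` sending `e_v` to `1`, the other
paths of length zero to `0` and every path of positive length to `0`. -/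
def vertexCharacter (v : V) : PathAlgebra k V →+* k where
  toFun f := f v v Quiver.Path.nil
  map_one' := by simp [one_apply_self]
  map_zero' := rfl
  map_add' f g := by simp
  map_mul' f g := by
    rw [mul_apply, Finsupp.finsetSum_apply, Finset.sum_eq_single v]
    · exact concat_apply_nil_self _ _
    · intro l _ hl
      exact concat_apply_nil _ _ hl
    · simp

end PathAlgebra

end PathAlgebra

/-! ### Almost gentle pairs and their algebras -/

section AlmostGentle

open PathAlgebra

variable {k : Type u} [Field k] {V : Type u} [Quiver.{u} V] [Fintype V] [DecidableEq V]

/-- `I` is an admissible ideal: `R ^ m ⊆ I ⊆ R ^ 2` for some `m ≥ 2`. Here `R` is the ideal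
generated by the arrows, so `R ^ m` is the span of the paths of length at least `m`. -/
structure IsAdmissible (I : TwoSidedIdeal (PathAlgebra k V)) : Prop where
  pow_le : ∃ m : ℕ, 2 ≤ m ∧ ∀ (i j : V) (p : Quiver.Path i j), m ≤ p.length →
    (ofPath p : PathAlgebra k V) ∈ I
  le_sq : ∀ f ∈ I, ∀ (i j : V) (p : Quiver.Path i j), p.length < 2 → f i j p = 0

/-- `(Q, I)` is an almost gentle pair. A product `ab` of arrows that do not compose is zero,
hence lies in `I`. -/
structure IsAlmostGentle (I : TwoSidedIdeal (PathAlgebra k V)) : Prop where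
  admissible : IsAdmissible I
  /-- `I` is generated by some paths of length two -/
  generated : ∃ S : Set (Σ i j : V, Quiver.Path i j), (∀ p ∈ S, p.2.2.length = 2) ∧
    I = TwoSidedIdeal.span ((fun p => (ofPath p.2.2 : PathAlgebra k V)) '' S)
  /-- for any arrow `a` there is at most one arrow `b` with `ab ∉ I` -/
  subsingleton_right : ∀ a : Quiver.Total V,
    {b : Quiver.Total V | arrow k a * arrow k b ∉ I}.Subsingleton
  /-- for any arrow `a` there is at most one arrow `c` with `ca ∉ I` -/
  subsingleton_left : ∀ a : Quiver.Total V,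
    {c : Quiver.Total V | arrow k c * arrow k a ∉ I}.Subsingleton

/-- The bound quiver algebra `A = kQ / I`. -/
abbrev BoundQuiverAlgebra (I : TwoSidedIdeal (PathAlgebra k V)) : Type u := I.ringCon.Quotient

/-- The character of `A = kQ / I` (with `I` admissible) belonging to the vertex `v`: it sends
`e_v` to `1`, and the other `e_w` and all arrows to `0`. -/
def BoundQuiverAlgebra.vertexCharacter {I : TwoSidedIdeal (PathAlgebra k V)}
    (hI : IsAdmissible I) (v : V) : BoundQuiverAlgebra I →+* k :=
  I.ringCon.lift (PathAlgebra.vertexCharacter k v) fun f g h => by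
    have h1 := hI.le_sq _ ((TwoSidedIdeal.rel_iff I f g).1 h) v v Quiver.Path.nil (by simp)
    exact sub_eq_zero.1 (((PathAlgebra.vertexCharacter k v).map_sub f g).symm.trans h1)

/-- The simple right `A`-module `S(v)`: the one-dimensional space `k`, on which `e_v` acts as the
identity and the other `e_w` and all arrows act as zero. Right `A`-modules are `Aᵐᵒᵖ`-modules. -/
def simpleModule {I : TwoSidedIdeal (PathAlgebra k V)} (hI : IsAdmissible I) (v : V) :
    ModuleCat.{u} (BoundQuiverAlgebra I)ᵐᵒᵖ :=
  (ModuleCat.restrictScalars ((BoundQuiverAlgebra.vertexCharacter hI v).fromOpposite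
    fun _ _ => mul_comm _ _)).obj (ModuleCat.of k k)

/-! ### Forbidden paths -/

/-- Any two consecutive arrows `a`, `b` of the path satisfy `ab ∈ I`. -/
def ConsecutiveInIdeal (I : TwoSidedIdeal (PathAlgebra k V)) {i : V} :
    ∀ {j : V}, Quiver.Path i j → Prop
  | _, .nil => True
  | _, .cons .nil _ => True
  | _, .cons (.cons p a) b =>
      ConsecutiveInIdeal I (.cons p a) ∧ (ofPath a.toPath * ofPath b.toPath : PathAlgebra k V) ∈ I

/-- The conditions under which the path `e_v` of length zero is forbidden. -/
def IsForbiddenVertex (I : TwoSidedIdeal (PathAlgebra k V)) (v : V) : Prop :=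
  (∃ a b : Quiver.Total V, (∀ c : Quiver.Total V, c.right = v ↔ c = a) ∧
    (∀ c : Quiver.Total V, c.left = v ↔ c = b) ∧ arrow k a * arrow k b ∈ I) ∨
  ((∀ c : Quiver.Total V, c.right ≠ v) ∧ ∃! a : Quiver.Total V, a.left = v) ∨
  ((∀ c : Quiver.Total V, c.left ≠ v) ∧ ∃! a : Quiver.Total V, a.right = v)

/-- The set of all forbidden paths starting at `v`. A path of length at least one is forbidden if
all products of consecutive arrows on it lie in `I`. -/
def forbiddenPaths (I : TwoSidedIdeal (PathAlgebra k V)) (v : V) :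
    Set (Σ w : V, Quiver.Path v w) :=
  {F | (1 ≤ F.2.length ∧ ConsecutiveInIdeal I F.2) ∨ (F.2.length = 0 ∧ IsForbiddenVertex I v)}

end AlmostGentle

end

noncomputable section

/-! ### Projective dimension of finite products, and dimension shifting -/

section ProjectiveDimension

variable {R : Type u} [Ring R]

/-! `I` is generated by paths of length two, so it is spanned by the paths that contain two
consecutive arrows with product in `I` (`mem_iff_containsRelation`). Membership in `I` can thus be
tested one path at a time, and first syzygies can be read off combinatorially.

The projective cover `e_v A → S(v)` has kernel `⨁ aA` over the arrows `a` starting at `v`. For an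
arrow `a` ending at `t`, left multiplication `e_t A → aA` has kernel `⨁ bA` over the arrows `b`
starting at `t` with `ab ∈ I`: a relation in `ap` either lies in `p` or consists of `a` and the
first arrow of `p`. The sums are direct because paths with different first arrows are different
basis elements. The next syzygies are again of the form `bA`, so the resolution unfolds along
forbidden paths.

The recursion ends when a module `eA / ⨁ bA` of this kind is projective, which happens only if no
`b` is left. A splitting would give a lift `y` of the generator with `yb = 0`; but `y` has
coefficient `1` at the trivial path, so `yb` has coefficient `1` at the arrow `b` and is nonzero by
`I ⊆ R ^ 2`.

Dimension shifting then shows that `aA` has projective dimension at most `n` iff no forbidden path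
of length `n + 2` begins with `a`, and that `S(v)` has projective dimension at most `n` iff no
forbidden path of length `n + 1` starts at `v`. Initial segments of positive length of a forbidden
path are forbidden, so the latter condition bounds all lengths by `n`. -/

theorem hasProjectiveDimensionLT_of_linearEquiv {M N : Type u} [AddCommGroup M] [Module R M]
    [AddCommGroup N] [Module R N] (e : M ≃ₗ[R] N) (n : ℕ)
    (h : HasProjectiveDimensionLT (ModuleCat.of R M) n) :
    HasProjectiveDimensionLT (ModuleCat.of R N) n :=
  hasProjectiveDimensionLT_of_iso e.toModuleIso n

theorem hasProjectiveDimensionLT_pi {ι : Type u} [Finite ι] (n : ℕ) (N : ι → Type u)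
    [∀ i, AddCommGroup (N i)] [∀ i, Module R (N i)]
    (h : ∀ i, HasProjectiveDimensionLT (ModuleCat.of R (N i)) n) :
    HasProjectiveDimensionLT (ModuleCat.of R (∀ i, N i)) n := by
  revert N
  induction ι using Finite.induction_empty_option with
  | of_equiv e ih =>
    intro N _ _ h
    exact hasProjectiveDimensionLT_of_linearEquiv (LinearEquiv.piCongrLeft R N e) n
      (ih _ fun i => h (e i))
  | h_empty =>
    intro N _ _ _
    have := (ModuleCat.isZero_of_subsingleton
      (ModuleCat.of R (∀ i, N i))).hasProjectiveDimensionLT_zero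
    exact hasProjectiveDimensionLT_of_ge _ 0 n n.zero_le
  | h_option ih =>
    intro N _ _ h
    have h₁ := h none
    have h₂ := ih (fun i => N (some i)) fun i => h (some i)
    have h₃ := hasProjectiveDimensionLT_of_iso (ModuleCat.biprodIsoProd
      (ModuleCat.of R (N none)) (ModuleCat.of R (∀ i, N (some i)))) n
    exact hasProjectiveDimensionLT_of_linearEquiv
      (LinearEquiv.piOptionEquivProd R (M := N)).symm n h₃

theorem hasProjectiveDimensionLT_pi_iff {ι : Type u} [Finite ι] (n : ℕ) (N : ι → Type u)
    [∀ i, AddCommGroup (N i)] [∀ i, Module R (N i)] :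
    HasProjectiveDimensionLT (ModuleCat.of R (∀ i, N i)) n ↔
      ∀ i, HasProjectiveDimensionLT (ModuleCat.of R (N i)) n := by
  classical
  refine ⟨fun h i => ?_, hasProjectiveDimensionLT_pi n N⟩
  refine Retract.hasProjectiveDimensionLT
    (Y := ModuleCat.of R (∀ i, N i)) ⟨ModuleCat.ofHom (LinearMap.single R N i),
      ModuleCat.ofHom (LinearMap.proj i), ?_⟩ n
  ext x
  simp

/-- Dimension shifting along a projective cover whose kernel is an internal direct sum. -/
theorem hasProjectiveDimensionLT_add_two_iff {P M : Type u} [AddCommGroup P] [Module R P]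
    [AddCommGroup M] [Module R M] [Module.Projective R P] {f : P →ₗ[R] M}
    (hf : Function.Surjective f) {ι : Type u} [Finite ι] {N : ι → Type u}
    [∀ i, AddCommGroup (N i)] [∀ i, Module R (N i)] {g : (∀ i, N i) →ₗ[R] P}
    (hg : Function.Injective g) (hfg : Function.Exact g f) (n : ℕ) :
    HasProjectiveDimensionLT (ModuleCat.of R M) (n + 2) ↔
      ∀ i, HasProjectiveDimensionLT (ModuleCat.of R (N i)) (n + 1) := by
  rw [← hasProjectiveDimensionLT_pi_iff]
  let S := ShortComplex.mk (ModuleCat.ofHom g) (ModuleCat.ofHom f)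
    (by ext1; exact hfg.linearMap_comp_eq_zero)
  have hS : S.ShortExact :=
    { exact := (ShortComplex.ShortExact.moduleCat_exact_iff_function_exact S).2 hfg
      mono_f := (ModuleCat.mono_iff_injective _).2 hg
      epi_g := (ModuleCat.epi_iff_surjective _).2 hf }
  exact hS.hasProjectiveDimensionLT_X₃_iff n
    ((IsProjective.iff_projective P).1 inferInstance)

theorem hasProjectiveDimensionLT_one_iff {M : Type u} [AddCommGroup M] [Module R M] :
    HasProjectiveDimensionLT (ModuleCat.of R M) 1 ↔ Module.Projective R M := by
  rw [← projective_iff_hasProjectiveDimensionLT_one]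
  exact (IsProjective.iff_projective M).symm

end ProjectiveDimension

/-! ### Cancellation of the first arrow of a path -/

section Path

variable {V : Type u} [Quiver.{u} V]

/-- Paths are built by appending arrows at the end, so reading off the first arrow takes an
induction on the tail. The equality is one of dependent triples because the intermediate vertices
are not known to agree beforehand. -/
theorem Quiver.Path.toPath_comp_injective {i j j' m : V} {a : i ⟶ j} {a' : i ⟶ j'}
    {p : Quiver.Path j m} {p' : Quiver.Path j' m} (h : a.toPath.comp p = a'.toPath.comp p') :
    (⟨j, a, p⟩ : Σ j, (i ⟶ j) × Quiver.Path j m) = ⟨j', a', p'⟩ := by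
  induction p with
  | nil =>
    cases p' with
    | nil => cases h; rfl
    | cons q c =>
      have := congrArg Quiver.Path.length h
      simp [Quiver.Path.length_comp] at this
  | cons p c ih =>
    cases p' with
    | nil =>
      have := congrArg Quiver.Path.length h
      simp [Quiver.Path.length_comp] at this
    | cons q d =>
      rw [Quiver.Path.comp_cons, Quiver.Path.comp_cons] at h
      obtain rfl := Quiver.Path.obj_eq_of_cons_eq_cons h
      have h₁ := ih (eq_of_heq (Quiver.Path.heq_of_cons_eq_cons h))
      obtain rfl := eq_of_heq (Quiver.Path.hom_heq_of_cons_eq_cons h)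
      cases h₁
      rfl

end Path

/-! ### Ideals generated by paths of length two -/

section MonomialIdeal

open PathAlgebra

variable {k : Type u} [Field k] {V : Type u} [Quiver.{u} V]

namespace PathAlgebra

theorem concat_apply_ne_zero {i l j : V} {f : Quiver.Path i l →₀ k} {g : Quiver.Path l j →₀ k}
    {p : Quiver.Path i j} (h : concat f g p ≠ 0) :
    ∃ u w, p = u.comp w ∧ f u ≠ 0 ∧ g w ≠ 0 := by
  classical
  by_contra! hc
  apply h
  rw [concat, Finsupp.sum, Finsupp.finsetSum_apply]
  refine Finset.sum_eq_zero fun u hu => ?_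
  rw [Finsupp.sum, Finsupp.finsetSum_apply]
  refine Finset.sum_eq_zero fun w hw => ?_
  rw [Finsupp.single_apply, if_neg]
  rintro rfl
  exact Finsupp.mem_support_iff.1 hw (hc u w rfl (Finsupp.mem_support_iff.1 hu))

theorem single_one_concat {i l j : V} (p : Quiver.Path i l) (g : Quiver.Path l j →₀ k) :
    concat (Finsupp.single p 1) g = g.mapDomain p.comp := by
  simp [concat, Finsupp.mapDomain, -Finsupp.single_mul]

theorem concat_single_one {i l j : V} (f : Quiver.Path i l →₀ k) (p : Quiver.Path l j) :
    concat f (Finsupp.single p 1) = f.mapDomain fun u => u.comp p := by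
  simp [concat, Finsupp.mapDomain, -Finsupp.single_mul]

variable [Fintype V] [DecidableEq V]

theorem mul_apply_ne_zero {f g : PathAlgebra k V} {i j : V} {p : Quiver.Path i j}
    (h : (f * g) i j p ≠ 0) :
    ∃ l, ∃ (u : Quiver.Path i l) (w : Quiver.Path l j),
      p = u.comp w ∧ f i l u ≠ 0 ∧ g l j w ≠ 0 := by
  rw [mul_apply, Finsupp.finsetSum_apply] at h
  obtain ⟨l, -, hl⟩ := Finset.exists_ne_zero_of_sum_ne_zero h
  exact ⟨l, concat_apply_ne_zero hl⟩

theorem ofPath_apply_ne_zero {i j i' j' : V} {p : Quiver.Path i j} {q : Quiver.Path i' j'}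
    (h : (ofPath p : PathAlgebra k V) i' j' q ≠ 0) :
    (⟨i', j', q⟩ : Σ i j : V, Quiver.Path i j) = ⟨i, j, p⟩ := by
  classical
  by_cases hi : i' = i
  · subst hi
    by_cases hj : j' = j
    · subst hj
      rw [ofPath_apply_self, Finsupp.single_apply] at h
      rw [show p = q by by_contra hpq; exact h (if_neg hpq)]
    · exact absurd (by rw [ofPath_apply_of_ne_right p hj]; rfl) h
  · exact absurd (by rw [ofPath_apply_of_ne_left p hi]; rfl) h

theorem ofPath_mul_apply {i j : V} (p : Quiver.Path i j) (x : PathAlgebra k V) (m : V) :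
    (ofPath p * x : PathAlgebra k V) i m = (x j m).mapDomain p.comp := by
  rw [mul_apply, Finset.sum_eq_single j]
  · rw [ofPath_apply_self, single_one_concat]
  · intro l _ hl
    rw [ofPath_apply_of_ne_right p hl, zero_concat]
  · simp

theorem ofPath_mul_apply_comp {i j m : V} (p : Quiver.Path i j) (x : PathAlgebra k V)
    (q : Quiver.Path j m) : (ofPath p * x : PathAlgebra k V) i m (p.comp q) = x j m q := by
  rw [ofPath_mul_apply, Finsupp.mapDomain_apply p.comp_injective_right]

theorem ofPath_mul_apply_ne_zero {i j i' m : V} {p : Quiver.Path i j} {x : PathAlgebra k V}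
    {q : Quiver.Path i' m} (h : (ofPath p * x : PathAlgebra k V) i' m q ≠ 0) :
    ∃ r : Quiver.Path j m, (⟨i', q⟩ : Σ i, Quiver.Path i m) = ⟨i, p.comp r⟩ ∧ x j m r ≠ 0 := by
  obtain ⟨l, u, w, rfl, hu, hw⟩ := mul_apply_ne_zero h
  cases ofPath_apply_ne_zero hu
  exact ⟨w, rfl, hw⟩

theorem mul_ofPath_apply_comp {i j m : V} (p : Quiver.Path j m) (x : PathAlgebra k V)
    (q : Quiver.Path i j) : (x * ofPath p : PathAlgebra k V) i m (q.comp p) = x i j q := by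
  rw [mul_apply, Finset.sum_eq_single j]
  · rw [ofPath_apply_self, concat_single_one]
    exact Finsupp.mapDomain_apply p.comp_injective_left _ _
  · intro l _ hl
    rw [ofPath_apply_of_ne_left p hl, concat_zero]
  · simp

/-- The component of the path algebra spanned by the paths from `i` to `j`. -/
def ofComponent (i j : V) : (Quiver.Path i j →₀ k) →+ PathAlgebra k V :=
  (AddMonoidHom.single (fun i => ∀ j : V, (Quiver.Path i j →₀ k)) i).comp
    (AddMonoidHom.single (fun j => Quiver.Path i j →₀ k) j)

theorem ofComponent_single {i j : V} (p : Quiver.Path i j) (c : k) :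
    ofComponent i j (Finsupp.single p c) = c • (ofPath p : PathAlgebra k V) := by
  ext1 i' j'
  rw [smul_apply]
  change (Pi.single i (Pi.single j (Finsupp.single p c)) :
    ∀ i j : V, (Quiver.Path i j →₀ k)) i' j' = _
  by_cases hi : i' = i
  · subst hi
    by_cases hj : j' = j
    · subst hj
      simp [ofPath]
    · simp [ofPath, hj]
  · simp [ofPath, hi]

theorem eq_sum_ofComponent (f : PathAlgebra k V) : f = ∑ i, ∑ j, ofComponent i j (f i j) := by
  have h₁ : ∀ i, (∑ j, Pi.single j (f i j) : ∀ j, (Quiver.Path i j →₀ k)) = f i :=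
    fun i => Finset.univ_sum_single (f i)
  have h₂ : (∑ i, Pi.single i (f i) : ∀ i j : V, (Quiver.Path i j →₀ k)) = f :=
    Finset.univ_sum_single f
  refine h₂.symm.trans (Finset.sum_congr rfl fun i _ => ?_)
  conv_lhs => rw [← h₁ i]
  exact map_sum (AddMonoidHom.single (fun i => ∀ j : V, (Quiver.Path i j →₀ k)) i) _ _

/-- `W` is only an additive submonoid so that this applies both to two-sided ideals and to preimages
in `kQ` of right submodules of `A`; the scalars are therefore part of the hypothesis. -/
theorem mem_of_smul_ofPath_mem (W : AddSubmonoid (PathAlgebra k V)) (f : PathAlgebra k V)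
    (h : ∀ (i j : V) (p : Quiver.Path i j), f i j p ≠ 0 →
      ∀ c : k, c • (ofPath p : PathAlgebra k V) ∈ W) : f ∈ W := by
  rw [eq_sum_ofComponent f]
  refine sum_mem fun i _ => sum_mem fun j _ => ?_
  rw [← Finsupp.sum_single (f i j), Finsupp.sum, map_sum]
  refine sum_mem fun p hp => ?_
  rw [ofComponent_single]
  exact h i j p (Finsupp.mem_support_iff.1 hp) _

end PathAlgebra

variable [Fintype V] [DecidableEq V]

/-- The path contains two consecutive arrows whose product lies in `I`. -/
def ContainsRelation (I : TwoSidedIdeal (PathAlgebra k V)) {i j : V} (p : Quiver.Path i j) : Prop :=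
  ∃ (l m n : V) (u : Quiver.Path i l) (a : l ⟶ m) (b : m ⟶ n) (w : Quiver.Path n j),
    p = u.comp (a.toPath.comp (b.toPath.comp w)) ∧
      (ofPath a.toPath * ofPath b.toPath : PathAlgebra k V) ∈ I

namespace ContainsRelation

variable {I : TwoSidedIdeal (PathAlgebra k V)}

theorem comp_left {i j m : V} {p : Quiver.Path j m} (h : ContainsRelation I p)
    (q : Quiver.Path i j) : ContainsRelation I (q.comp p) := by
  obtain ⟨_, _, _, u, a, b, w, rfl, hab⟩ := h
  exact ⟨_, _, _, q.comp u, a, b, w, by rw [Quiver.Path.comp_assoc], hab⟩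

theorem comp_right {i j m : V} {p : Quiver.Path i j} (h : ContainsRelation I p)
    (q : Quiver.Path j m) : ContainsRelation I (p.comp q) := by
  obtain ⟨_, _, _, u, a, b, w, rfl, hab⟩ := h
  exact ⟨_, _, _, u, a, b, w.comp q, by simp only [Quiver.Path.comp_assoc], hab⟩

theorem ofPath_mem {i j : V} {p : Quiver.Path i j} (h : ContainsRelation I p) :
    (ofPath p : PathAlgebra k V) ∈ I := by
  obtain ⟨_, _, _, u, a, b, w, rfl, hab⟩ := h
  rw [← ofPath_mul_ofPath, ← ofPath_mul_ofPath, ← ofPath_mul_ofPath, ← mul_assoc (ofPath a.toPath)]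
  exact I.mul_mem_left _ _ (I.mul_mem_right _ _ hab)

/-- The relation either avoids the initial arrow `a` or uses it, according to whether the part of
the path before the relation is nontrivial. This computes the right annihilator of `a` in `A`. -/
theorem of_toPath_comp {i j m : V} {a : i ⟶ j} {p : Quiver.Path j m}
    (h : ContainsRelation I (a.toPath.comp p)) :
    ContainsRelation I p ∨ ∃ (l : V) (b : j ⟶ l) (q : Quiver.Path l m), p = b.toPath.comp q ∧
      (ofPath a.toPath * ofPath b.toPath : PathAlgebra k V) ∈ I := by
  obtain ⟨l, _, _, u, x, y, w, h, hxy⟩ := h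
  by_cases hu : u.length = 0
  · obtain rfl := Quiver.Path.eq_of_length_zero u hu
    obtain rfl := Quiver.Path.eq_nil_of_length_zero u hu
    rw [Quiver.Path.nil_comp] at h
    cases Quiver.Path.toPath_comp_injective h
    exact Or.inr ⟨_, y, w, rfl, hxy⟩
  · obtain ⟨_, c, u, rfl, -⟩ := (Quiver.Path.length_ne_zero_iff_eq_comp u).1 hu
    rw [Quiver.Path.comp_assoc] at h
    cases Quiver.Path.toPath_comp_injective h
    exact Or.inl ⟨_, _, _, u, x, y, w, rfl, hxy⟩

end ContainsRelation

/-- The ideal spanned by the paths that contain a relation. -/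
def relationIdeal (I : TwoSidedIdeal (PathAlgebra k V)) : TwoSidedIdeal (PathAlgebra k V) :=
  TwoSidedIdeal.mk' {f | ∀ (i j : V) (p : Quiver.Path i j), f i j p ≠ 0 → ContainsRelation I p}
    (fun _ _ _ h => absurd rfl h)
    (fun {f g} hf hg i j p h => by
      by_cases h₁ : f i j p = 0
      · refine hg i j p fun h₂ => h ?_
        rw [PathAlgebra.add_apply, Finsupp.add_apply, h₁, h₂, add_zero]
      · exact hf i j p h₁)
    (fun {f} hf i j p h => hf i j p fun h₁ => h (show -(f i j p) = 0 by rw [h₁, neg_zero]))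
    (fun {f g} hg i j p h => by
      obtain ⟨l, u, w, rfl, -, hw⟩ := mul_apply_ne_zero h
      exact (hg _ _ _ hw).comp_left u)
    (fun {f g} hf i j p h => by
      obtain ⟨l, u, w, rfl, hu, -⟩ := mul_apply_ne_zero h
      exact (hf _ _ _ hu).comp_right w)

theorem smul_mem_of_mem (I : TwoSidedIdeal (PathAlgebra k V)) (c : k) {f : PathAlgebra k V}
    (hf : f ∈ I) : c • f ∈ I := by
  rw [← one_mul f, ← smul_mul_assoc]
  exact I.mul_mem_left _ _ hf

/-- An ideal generated by paths of length two is spanned by the paths containing a relation. -/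
theorem mem_iff_containsRelation {I : TwoSidedIdeal (PathAlgebra k V)}
    (hI : ∃ S : Set (Σ i j : V, Quiver.Path i j), (∀ p ∈ S, p.2.2.length = 2) ∧
      I = TwoSidedIdeal.span ((fun p => (ofPath p.2.2 : PathAlgebra k V)) '' S))
    (f : PathAlgebra k V) :
    f ∈ I ↔ ∀ (i j : V) (p : Quiver.Path i j), f i j p ≠ 0 → ContainsRelation I p := by
  constructor
  · obtain ⟨S, hS, hI⟩ := hI
    -- The generators are themselves relations, and the span of the paths containing a relation is a
    -- two-sided ideal.
    have hle : I ≤ relationIdeal I := by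
      conv_lhs => rw [hI]
      rw [TwoSidedIdeal.span_le]
      rintro _ ⟨⟨i, j, p⟩, hp, rfl⟩
      refine (TwoSidedIdeal.mem_mk' ..).2 fun i' j' q hq => ?_
      cases ofPath_apply_ne_zero hq
      clear hq
      obtain ⟨_, a, q, hq, rfl⟩ := Quiver.Path.eq_toPath_comp_of_length_eq_succ p (hS _ hp)
      obtain ⟨_, b, w, hw, rfl⟩ := Quiver.Path.eq_toPath_comp_of_length_eq_succ q hq
      obtain rfl := Quiver.Path.eq_of_length_zero w hw
      obtain rfl := Quiver.Path.eq_nil_of_length_zero w hw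
      refine ⟨_, _, _, Quiver.Path.nil, a, b, Quiver.Path.nil, by rw [Quiver.Path.nil_comp], ?_⟩
      rw [hI, ofPath_mul_ofPath]
      exact TwoSidedIdeal.subset_span ⟨_, hp, rfl⟩
    exact fun h => (TwoSidedIdeal.mem_mk' ..).1 (hle h)
  · intro h
    exact mem_of_smul_ofPath_mem
      { carrier := {x | x ∈ I}, zero_mem' := I.zero_mem, add_mem' := I.add_mem } f
      fun i j p hp c => smul_mem_of_mem I c (h i j p hp).ofPath_mem

end MonomialIdeal

/-! ### Quotients of `eA` by direct sums of principal right ideals -/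

section RightIdeal

variable {A : Type u} [Ring A]

/-- The right ideal `xA`. -/
def principalRightIdeal (x : A) : Submodule Aᵐᵒᵖ A where
  carrier := {y | ∃ z, x * z = y}
  add_mem' := by
    rintro _ _ ⟨z, rfl⟩ ⟨w, rfl⟩
    exact ⟨z + w, mul_add _ _ _⟩
  zero_mem' := ⟨0, mul_zero _⟩
  smul_mem' := by
    rintro c _ ⟨z, rfl⟩
    exact ⟨z * c.unop, by rw [MulOpposite.smul_eq_mul_unop, mul_assoc]⟩

theorem mem_principalRightIdeal_iff_of_idempotent {e y : A} (he : e * e = e) :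
    y ∈ principalRightIdeal e ↔ e * y = y := by
  refine ⟨?_, fun h => ⟨y, h⟩⟩
  rintro ⟨z, rfl⟩
  rw [← mul_assoc, he]

/-- Left multiplication by `x`, as a map of right ideals from `eA` onto `xA`. -/
def leftMulPrincipalRightIdeal (x e : A) :
    principalRightIdeal e →ₗ[Aᵐᵒᵖ] principalRightIdeal x where
  toFun y := ⟨x * y, y, rfl⟩
  map_add' _ _ := Subtype.ext (mul_add _ _ _)
  map_smul' c y := Subtype.ext (by
    simp only [Submodule.coe_smul, MulOpposite.smul_eq_mul_unop, RingHom.id_apply, mul_assoc])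

theorem leftMulPrincipalRightIdeal_surjective (x e : A) (hx : x * e = x) :
    Function.Surjective (leftMulPrincipalRightIdeal x e) := by
  rintro ⟨_, z, rfl⟩
  refine ⟨⟨e * z, z, rfl⟩, Subtype.ext ?_⟩
  change x * (e * z) = x * z
  rw [← mul_assoc, hx]

theorem projective_principalRightIdeal {e : A} (he : e * e = e) :
    Module.Projective Aᵐᵒᵖ (principalRightIdeal e) := by
  have hA : Module.Projective Aᵐᵒᵖ A := Module.Projective.of_equiv
    { toFun := MulOpposite.unop
      invFun := MulOpposite.op
      map_add' := fun _ _ => rfl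
      map_smul' := fun _ _ => rfl : Aᵐᵒᵖ ≃ₗ[Aᵐᵒᵖ] A }
  refine Module.Projective.of_split (principalRightIdeal e).subtype
    { toFun := fun y => ⟨e * y, y, rfl⟩
      map_add' := fun _ _ => Subtype.ext (mul_add _ _ _)
      map_smul' := fun c y => Subtype.ext (by
        simp only [Submodule.coe_smul, MulOpposite.smul_eq_mul_unop, RingHom.id_apply,
          mul_assoc]) } ?_
  ext y
  exact (mem_principalRightIdeal_iff_of_idempotent he).1 y.2

/-- Dimension shifting for a quotient of `eA` by a direct sum of principal right ideals. -/
theorem hasProjectiveDimensionLT_add_two_iff_principalRightIdeal {e : A} (he : e * e = e)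
    {M : Type u} [AddCommGroup M] [Module Aᵐᵒᵖ M] {f : principalRightIdeal e →ₗ[Aᵐᵒᵖ] M}
    (hf : Function.Surjective f) {ι : Type u} [Fintype ι] (b : ι → A) (hb : ∀ i, e * b i = b i)
    (hfb : ∀ i, f ⟨b i, b i, hb i⟩ = 0)
    (hker : ∀ y, f y = 0 → (y : A) ∈ ⨆ i, principalRightIdeal (b i))
    (hind : ∀ y : ι → A, ∑ i, b i * y i = 0 → ∀ i, b i * y i = 0)
    (n : ℕ) :
    HasProjectiveDimensionLT (ModuleCat.of Aᵐᵒᵖ M) (n + 2) ↔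
      ∀ i, HasProjectiveDimensionLT (ModuleCat.of Aᵐᵒᵖ (principalRightIdeal (b i))) (n + 1) := by
  classical
  have := projective_principalRightIdeal he
  have hle : ∀ i, principalRightIdeal (b i) ≤ principalRightIdeal e := by
    rintro i _ ⟨z, rfl⟩
    exact ⟨b i * z, by rw [← mul_assoc, hb]⟩
  let g : (∀ i, principalRightIdeal (b i)) →ₗ[Aᵐᵒᵖ] principalRightIdeal e :=
    ∑ i, (Submodule.inclusion (hle i)).comp (LinearMap.proj i)
  have hg : ∀ y, (g y : A) = ∑ i, (y i : A) := fun y => by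
    simp [g]
  refine hasProjectiveDimensionLT_add_two_iff hf (g := g) ?_ ?_ n
  · rw [injective_iff_map_eq_zero]
    intro y hy
    choose z hz using fun i => (y i).2
    have h := congrArg Subtype.val hy
    rw [hg, Submodule.coe_zero] at h
    simp only [← hz] at h
    funext i
    exact Subtype.ext ((hz i).symm.trans (hind z h i))
  · intro y
    constructor
    · intro hy
      obtain ⟨z, hz⟩ := (Submodule.mem_iSup_iff_exists_finsupp _ _).1 (hker y hy)
      refine ⟨fun i => ⟨z i, hz.1 i⟩, Subtype.ext ((hg _).trans ?_)⟩
      exact (Finsupp.sum_fintype z (fun _ x => x) fun _ => rfl).symm.trans hz.2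
    · rintro ⟨z, rfl⟩
      rw [show g z = ∑ i, Submodule.inclusion (hle i) (z i) by simp [g], map_sum]
      refine Finset.sum_eq_zero fun i _ => ?_
      obtain ⟨w, hw⟩ := (z i).2
      have : Submodule.inclusion (hle i) (z i) =
          MulOpposite.op w • (⟨b i, b i, hb i⟩ : principalRightIdeal e) := by
        exact Subtype.ext hw.symm
      rw [this, map_smul, hfb, smul_zero]

theorem injective_of_isEmpty_of_ker_le {e : A} {M : Type u} [AddCommGroup M] [Module Aᵐᵒᵖ M]
    {f : principalRightIdeal e →ₗ[Aᵐᵒᵖ] M} {ι : Type u} [IsEmpty ι] (b : ι → A)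
    (hker : ∀ y, f y = 0 → (y : A) ∈ ⨆ i, principalRightIdeal (b i)) : Function.Injective f := by
  rw [injective_iff_map_eq_zero]
  intro y hy
  have := hker y hy
  rw [iSup_of_empty, Submodule.mem_bot] at this
  exact Subtype.ext this

/-- A quotient of `eA` is projective if and only if the kernel is zero, provided that preimages of
a generator are never annihilated by the generators of the kernel. -/
theorem hasProjectiveDimensionLT_one_iff_isEmpty {e : A} (he : e * e = e)
    {M : Type u} [AddCommGroup M] [Module Aᵐᵒᵖ M] {f : principalRightIdeal e →ₗ[Aᵐᵒᵖ] M}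
    (hf : Function.Surjective f) {ι : Type u} (b : ι → A) (hb : ∀ i, e * b i = b i)
    (hfb : ∀ i, f ⟨b i, b i, hb i⟩ = 0)
    (hker : ∀ y, f y = 0 → (y : A) ∈ ⨆ i, principalRightIdeal (b i))
    (hne : ∀ y, f y = f ⟨e, e, he⟩ → ∀ i, (y : A) * b i ≠ 0) :
    HasProjectiveDimensionLT (ModuleCat.of Aᵐᵒᵖ M) 1 ↔ IsEmpty ι := by
  rw [hasProjectiveDimensionLT_one_iff]
  constructor
  · intro hM
    -- For a section `s`, the element `y = s (f e)` lifts `f e`, while `y * b i = s (f (b i)) = 0`;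
    -- this contradicts `hne`.
    obtain ⟨s, hs⟩ := Module.projective_lifting_property f LinearMap.id hf
    refine ⟨fun i => hne (s (f ⟨e, e, he⟩)) (LinearMap.congr_fun hs _) i ?_⟩
    have h : MulOpposite.op (b i) • (⟨e, e, he⟩ : principalRightIdeal e) = ⟨b i, b i, hb i⟩ :=
      Subtype.ext (hb i)
    have h' := congrArg (fun y => ((s (f y) : principalRightIdeal e) : A)) h
    simp only [map_smul, hfb, map_zero] at h'
    exact h'
  · intro hι
    have := projective_principalRightIdeal he
    exact Module.Projective.of_equiv
      (LinearEquiv.ofBijective f ⟨injective_of_isEmpty_of_ker_le b hker, hf⟩)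

end RightIdeal

/-! ### Forbidden paths, read from their first arrow -/

section ForbiddenPath

open PathAlgebra

variable {k : Type u} [Field k] {V : Type u} [Quiver.{u} V] [Fintype V] [DecidableEq V]

/-- `ConsecutiveInIdeal` recurses from the end of a path, whereas syzygies peel off arrows at the
start; this passes from one to the other. -/
theorem consecutiveInIdeal_toPath_comp (I : TwoSidedIdeal (PathAlgebra k V)) {i j l m : V}
    (a : i ⟶ j) (b : j ⟶ l) (q : Quiver.Path l m) :
    ConsecutiveInIdeal I (a.toPath.comp (b.toPath.comp q)) ↔
      (ofPath a.toPath * ofPath b.toPath : PathAlgebra k V) ∈ I ∧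
        ConsecutiveInIdeal I (b.toPath.comp q) := by
  induction q with
  | nil =>
    change True ∧ _ ↔ _ ∧ True
    rw [true_and, and_true]
  | cons q c ih =>
    cases q with
    | nil =>
      change (True ∧ _) ∧ _ ↔ _ ∧ True ∧ _
      simp only [true_and]
    | cons q d =>
      change ConsecutiveInIdeal I (a.toPath.comp (b.toPath.comp (q.cons d))) ∧ _ ↔
        _ ∧ ConsecutiveInIdeal I (b.toPath.comp (q.cons d)) ∧ _
      rw [ih, and_assoc]

/-- There is a forbidden path of length `n + 1` that begins with the arrow `a`. -/
def StartsForbidden (I : TwoSidedIdeal (PathAlgebra k V)) : ℕ → ∀ {i j : V}, (i ⟶ j) → Prop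
  | 0, _, _, _ => True
  | n + 1, _, j, a => ∃ (l : V) (b : j ⟶ l),
      (ofPath a.toPath * ofPath b.toPath : PathAlgebra k V) ∈ I ∧ StartsForbidden I n b

variable {I : TwoSidedIdeal (PathAlgebra k V)}

theorem StartsForbidden.of_succ {n : ℕ} {i j : V} {a : i ⟶ j}
    (h : StartsForbidden I (n + 1) a) : StartsForbidden I n a := by
  induction n generalizing i j with
  | zero => trivial
  | succ n ih =>
    obtain ⟨l, b, hab, hb⟩ := h
    exact ⟨l, b, hab, ih hb⟩

theorem StartsForbidden.of_le {m n : ℕ} (hmn : n ≤ m) {i j : V} {a : i ⟶ j}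
    (h : StartsForbidden I m a) : StartsForbidden I n a := by
  induction hmn with
  | refl => exact h
  | step _ ih => exact ih h.of_succ

theorem startsForbidden_iff {n : ℕ} {i j : V} {a : i ⟶ j} :
    StartsForbidden I n a ↔ ∃ (m : V) (q : Quiver.Path j m), q.length = n ∧
      ConsecutiveInIdeal I (a.toPath.comp q) := by
  induction n generalizing i j with
  | zero => exact ⟨fun _ => ⟨j, Quiver.Path.nil, rfl, trivial⟩, fun _ => trivial⟩
  | succ n ih =>
    constructor
    · rintro ⟨l, b, hab, hb⟩
      obtain ⟨m, q, hq, hbq⟩ := ih.1 hb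
      refine ⟨m, b.toPath.comp q, ?_, (consecutiveInIdeal_toPath_comp I a b q).2 ⟨hab, hbq⟩⟩
      rw [Quiver.Path.length_comp, Quiver.Path.length_toPath, hq, add_comm]
    · rintro ⟨m, q, hq, hc⟩
      obtain ⟨l, b, q, hq', rfl⟩ := Quiver.Path.eq_toPath_comp_of_length_eq_succ q hq
      obtain ⟨hab, hbq⟩ := (consecutiveInIdeal_toPath_comp I a b q).1 hc
      exact ⟨l, b, hab, ih.2 ⟨m, q, hq', hbq⟩⟩

/-- A forbidden trivial path has length `0` and never affects the bound. A longer forbidden path can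
be truncated to length exactly `n + 1`. -/
theorem forall_forbiddenPaths_length_le_iff (v : V) (n : ℕ) :
    (∀ F ∈ forbiddenPaths I v, F.2.length ≤ n) ↔
      ∀ (j : V) (a : v ⟶ j), ¬ StartsForbidden I n a := by
  constructor
  · intro h j a ha
    obtain ⟨m, q, hq, hc⟩ := startsForbidden_iff.1 ha
    have hl : (a.toPath.comp q).length = n + 1 := by
      rw [Quiver.Path.length_comp, Quiver.Path.length_toPath, hq, add_comm]
    have := h ⟨m, a.toPath.comp q⟩ (Or.inl ⟨by simp only; omega, hc⟩)
    simp only at this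
    omega
  · rintro h ⟨m, F⟩ hF
    by_contra! hlt
    simp only at hlt
    obtain ⟨-, hc⟩ | ⟨h0, -⟩ := hF
    · obtain ⟨j, a, q, hq, rfl⟩ := Quiver.Path.eq_toPath_comp_of_length_eq_succ F
        (Nat.succ_pred_eq_of_pos (by omega : 0 < F.length)).symm
      have ha : StartsForbidden I q.length a := startsForbidden_iff.2 ⟨m, q, rfl, hc⟩
      rw [Quiver.Path.length_comp, Quiver.Path.length_toPath] at hlt
      exact h j a (ha.of_le (by omega))
    · simp only at h0
      omega

end ForbiddenPath

/-! ### Syzygies over the bound quiver algebra -/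

section AlmostGentleAlgebra

open PathAlgebra

variable {k : Type u} [Field k] {V : Type u} [Quiver.{u} V] [Fintype V] [DecidableEq V]

/-- The class of a path in the bound quiver algebra. -/
def BoundQuiverAlgebra.ofPath (I : TwoSidedIdeal (PathAlgebra k V)) {i j : V}
    (p : Quiver.Path i j) : BoundQuiverAlgebra I :=
  I.ringCon.mk' (PathAlgebra.ofPath p)

/-- The arrows starting at `t` that satisfy `B`. -/
abbrev ArrowsFrom {t : V} (B : ∀ l : V, (t ⟶ l) → Prop) : Type u := Σ l : V, {b : t ⟶ l // B l b}

namespace BoundQuiverAlgebra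

variable {I : TwoSidedIdeal (PathAlgebra k V)}

theorem mk'_eq_zero_iff {f : PathAlgebra k V} : I.ringCon.mk' f = 0 ↔ f ∈ I := by
  rw [TwoSidedIdeal.mem_iff, ← map_zero I.ringCon.mk']
  exact RingCon.eq I.ringCon

theorem ofPath_nil_mul_ofPath {i j : V} (p : Quiver.Path i j) :
    ofPath I (Quiver.Path.nil : Quiver.Path i i) * ofPath I p = ofPath I p := by
  rw [ofPath, ofPath, ← map_mul, ofPath_mul_ofPath, Quiver.Path.nil_comp]

theorem ofPath_mul_ofPath_nil {i j : V} (p : Quiver.Path i j) :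
    ofPath I p * ofPath I (Quiver.Path.nil : Quiver.Path j j) = ofPath I p := by
  rw [ofPath, ofPath, ← map_mul, ofPath_mul_ofPath, Quiver.Path.comp_nil]

theorem mk'_mem_iSup_principalRightIdeal {t : V} (B : ∀ l : V, (t ⟶ l) → Prop)
    (x : PathAlgebra k V)
    (h : ∀ (m : V) (p : Quiver.Path t m), x t m p ≠ 0 → ContainsRelation I p ∨
      ∃ (l : V) (b : t ⟶ l) (q : Quiver.Path l m), p = b.toPath.comp q ∧ B l b) :
    ofPath I (Quiver.Path.nil : Quiver.Path t t) * I.ringCon.mk' x ∈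
      ⨆ i : ArrowsFrom B, principalRightIdeal (ofPath I i.2.1.toPath) := by
  rw [ofPath, ← map_mul]
  refine mem_of_smul_ofPath_mem (AddSubmonoid.comap (I.ringCon.mk' : PathAlgebra k V →+ _)
    (⨆ i : ArrowsFrom B, principalRightIdeal (ofPath I i.2.1.toPath)).toAddSubmonoid) _ ?_
  intro i j p hp c
  obtain ⟨r, hr, hxr⟩ := ofPath_mul_apply_ne_zero hp
  cases hr
  rw [Quiver.Path.nil_comp]
  change I.ringCon.mk' _ ∈ (⨆ i : ArrowsFrom B, principalRightIdeal (ofPath I i.2.1.toPath))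
  obtain hr | ⟨l, b, q, rfl, hb⟩ := h j r hxr
  · rw [mk'_eq_zero_iff.2 (smul_mem_of_mem I c hr.ofPath_mem)]
    exact zero_mem _
  · refine Submodule.mem_iSup_of_mem (⟨l, b, hb⟩ : ArrowsFrom B) ?_
    refine ⟨I.ringCon.mk' (c • PathAlgebra.ofPath q), ?_⟩
    rw [ofPath, ← map_mul, mul_smul_comm, ofPath_mul_ofPath]

/-- Directness of the sum of the `bA`: summands with different first arrows share no path, so
nothing cancels, and membership in `I` is decided path by path. -/
theorem ofPath_mul_eq_zero_of_sum_eq_zero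
    (hI : ∃ S : Set (Σ i j : V, Quiver.Path i j), (∀ p ∈ S, p.2.2.length = 2) ∧
      I = TwoSidedIdeal.span ((fun p => (PathAlgebra.ofPath p.2.2 : PathAlgebra k V)) '' S))
    {t : V} (B : ∀ l : V, (t ⟶ l) → Prop) [Fintype (ArrowsFrom B)]
    (y : ArrowsFrom B → BoundQuiverAlgebra I)
    (h : ∑ i, ofPath I i.2.1.toPath * y i = 0) (i : ArrowsFrom B) :
    ofPath I i.2.1.toPath * y i = 0 := by
  choose x hx using fun i => I.ringCon.mk'_surjective (y i)
  simp only [← hx, ofPath, ← map_mul, ← map_sum, mk'_eq_zero_iff] at h ⊢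
  rw [mem_iff_containsRelation hI] at h ⊢
  intro j m p hp
  refine h j m p ?_
  obtain ⟨r, hr, -⟩ := ofPath_mul_apply_ne_zero hp
  cases hr
  rw [PathAlgebra.sum_apply, Finsupp.finsetSum_apply, Finset.sum_eq_single i]
  · exact hp
  · intro i' _ hi'
    by_contra hne
    obtain ⟨r', hr', -⟩ := ofPath_mul_apply_ne_zero hne
    have h₁ := Quiver.Path.toPath_comp_injective (eq_of_heq (Sigma.mk.inj hr').2)
    obtain ⟨l, b, hb⟩ := i
    obtain ⟨l', b', hb'⟩ := i'
    cases h₁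
    exact hi' rfl
  · exact fun hi => absurd (Finset.mem_univ i) hi

/-- The coefficient of `x b` at the arrow `b` is the coefficient of `x` at the trivial path, and
elements of `I` have no terms of length one. -/
theorem mk'_mul_ofPath_ne_zero (hI : IsAdmissible I) {t l : V} (x : PathAlgebra k V)
    (hx : x t t Quiver.Path.nil = 1) (b : t ⟶ l) :
    I.ringCon.mk' x * ofPath I b.toPath ≠ 0 := by
  intro h
  rw [ofPath, ← map_mul, mk'_eq_zero_iff] at h
  have h₁ := hI.le_sq _ h t l (Quiver.Path.nil.comp b.toPath) (by
    rw [Quiver.Path.nil_comp]; exact Nat.one_lt_two)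
  rw [mul_ofPath_apply_comp, hx] at h₁
  exact one_ne_zero h₁

end BoundQuiverAlgebra

open BoundQuiverAlgebra

variable {I : TwoSidedIdeal (PathAlgebra k V)}

/-- Induction on `n` along `0 → ⨁ bA → e_t A → aA → 0`, where `b` runs over the arrows with `ab ∈
I`. Both sides obey the same recursion. -/
theorem hasProjectiveDimensionLT_principalRightIdeal_arrow [∀ i j : V, Finite (i ⟶ j)]
    (hI : IsAlmostGentle I) (n : ℕ) {s t : V} (a : s ⟶ t) :
    HasProjectiveDimensionLT (ModuleCat.of (BoundQuiverAlgebra I)ᵐᵒᵖ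
      (principalRightIdeal (BoundQuiverAlgebra.ofPath I a.toPath))) (n + 1) ↔
      ¬ StartsForbidden I (n + 1) a := by
  let B : ∀ l : V, (t ⟶ l) → Prop := fun l b =>
    (PathAlgebra.ofPath a.toPath * PathAlgebra.ofPath b.toPath : PathAlgebra k V) ∈ I
  have := Fintype.ofFinite (ArrowsFrom B)
  let e := BoundQuiverAlgebra.ofPath I (Quiver.Path.nil : Quiver.Path t t)
  let x := BoundQuiverAlgebra.ofPath I a.toPath
  have he : e * e = e := ofPath_nil_mul_ofPath _
  have hxe : x * e = x := ofPath_mul_ofPath_nil _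
  have hf := leftMulPrincipalRightIdeal_surjective x e hxe
  let b : ArrowsFrom B → BoundQuiverAlgebra I := fun i => BoundQuiverAlgebra.ofPath I i.2.1.toPath
  have hb : ∀ i, e * b i = b i := fun i => ofPath_nil_mul_ofPath _
  have hfb : ∀ i, leftMulPrincipalRightIdeal x e ⟨b i, b i, hb i⟩ = 0 := fun i =>
    Subtype.ext ((map_mul I.ringCon.mk' _ _).symm.trans (mk'_eq_zero_iff.2 i.2.2))
  have hker : ∀ y, leftMulPrincipalRightIdeal x e y = 0 →
      (y : BoundQuiverAlgebra I) ∈ ⨆ i, principalRightIdeal (b i) := by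
    intro y hy
    obtain ⟨z, hz⟩ := I.ringCon.mk'_surjective (y : BoundQuiverAlgebra I)
    rw [← (mem_principalRightIdeal_iff_of_idempotent he).1 y.2, ← hz]
    refine mk'_mem_iSup_principalRightIdeal B z fun m p hp => ?_
    have hy' : x * (y : BoundQuiverAlgebra I) = 0 := congrArg Subtype.val hy
    rw [← hz] at hy'
    have hmem := mk'_eq_zero_iff.1 ((map_mul I.ringCon.mk' _ _).trans hy')
    refine ((mem_iff_containsRelation hI.generated _).1 hmem s m (a.toPath.comp p) ?_).of_toPath_comp
    rwa [ofPath_mul_apply_comp]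
  cases n with
  | zero =>
    refine (hasProjectiveDimensionLT_one_iff_isEmpty he hf b hb hfb hker ?_).trans ?_
    · intro y hy i
      obtain ⟨z, hz⟩ := I.ringCon.mk'_surjective (y : BoundQuiverAlgebra I)
      rw [← hz]
      refine mk'_mul_ofPath_ne_zero hI.admissible z ?_ _
      have hy' : x * (y : BoundQuiverAlgebra I) = x * e := congrArg Subtype.val hy
      rw [hxe, ← hz, ← sub_eq_zero] at hy'
      have hmem : PathAlgebra.ofPath a.toPath * z - PathAlgebra.ofPath a.toPath ∈ I :=
        mk'_eq_zero_iff.1 (by rw [map_sub, map_mul]; exact hy')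
      -- As `az - a ∈ I ⊆ R ^ 2`, its coefficient at `a` vanishes, so `z` has coefficient `1` at the
      -- trivial path.
      have h := hI.admissible.le_sq _ hmem s t a.toPath Nat.one_lt_two
      have h₁ := ofPath_mul_apply_comp a.toPath z Quiver.Path.nil
      rw [Quiver.Path.comp_nil] at h₁
      rw [← h₁]
      refine (sub_eq_zero.1 h).trans ?_
      rw [ofPath_apply_self, Finsupp.single_eq_same]
    · rw [← not_nonempty_iff, not_iff_not]
      exact ⟨fun ⟨i⟩ => ⟨i.1, i.2.1, i.2.2, trivial⟩, fun ⟨l, b, hab, _⟩ => ⟨⟨l, b, hab⟩⟩⟩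
  | succ n =>
    refine (hasProjectiveDimensionLT_add_two_iff_principalRightIdeal he hf b hb hfb hker
      (ofPath_mul_eq_zero_of_sum_eq_zero hI.generated B) n).trans ?_
    simp only [b, hasProjectiveDimensionLT_principalRightIdeal_arrow hI n]
    constructor
    · rintro h ⟨l, c, hac, hc⟩
      exact h ⟨l, c, hac⟩ hc
    · exact fun h i hi => h ⟨i.1, i.2.1, i.2.2, hi⟩

/-- The projection `e_v A → S(v)`. -/
def toSimpleModule (hI : IsAdmissible I) (v : V) :
    principalRightIdeal (BoundQuiverAlgebra.ofPath I (Quiver.Path.nil : Quiver.Path v v))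
      →ₗ[(BoundQuiverAlgebra I)ᵐᵒᵖ] simpleModule hI v where
  toFun y := (vertexCharacter hI v y : k)
  map_add' y z := map_add (vertexCharacter hI v) (y : BoundQuiverAlgebra I) z
  map_smul' c y := (map_mul (vertexCharacter hI v) (y : BoundQuiverAlgebra I) c.unop).trans
    (mul_comm _ _)

theorem vertexCharacter_mk' (hI : IsAdmissible I) (v : V) (x : PathAlgebra k V) :
    vertexCharacter hI v (I.ringCon.mk' x) = x v v Quiver.Path.nil := rfl

theorem vertexCharacter_ofPath_nil (hI : IsAdmissible I) (v : V) :
    vertexCharacter hI v (BoundQuiverAlgebra.ofPath I (Quiver.Path.nil : Quiver.Path v v)) = 1 := by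
  rw [BoundQuiverAlgebra.ofPath, vertexCharacter_mk', ofPath_apply_self, Finsupp.single_eq_same]

theorem toSimpleModule_surjective (hI : IsAdmissible I) (v : V) :
    Function.Surjective (toSimpleModule hI v) := by
  intro (c : k)
  refine ⟨⟨_, I.ringCon.mk' (algebraMap k _ c), rfl⟩, ?_⟩
  change vertexCharacter hI v (BoundQuiverAlgebra.ofPath I (Quiver.Path.nil : Quiver.Path v v) *
    I.ringCon.mk' (algebraMap k _ c)) = c
  rw [map_mul, vertexCharacter_ofPath_nil, one_mul, vertexCharacter_mk',
    Algebra.algebraMap_eq_smul_one, PathAlgebra.smul_apply, one_apply_self, Finsupp.smul_apply,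
    Finsupp.single_eq_same, smul_eq_mul, mul_one]

/-- The kernel of `e_v A → S(v)` is spanned by the classes of the paths of positive length from `v`.
Sorted by first arrow, they give `⨁ aA` over all arrows starting at `v`. -/
theorem hasProjectiveDimensionLT_simpleModule [∀ i j : V, Finite (i ⟶ j)]
    (hI : IsAlmostGentle I) (v : V) (n : ℕ) :
    HasProjectiveDimensionLT (simpleModule hI.admissible v) (n + 1) ↔
      ∀ (j : V) (a : v ⟶ j), ¬ StartsForbidden I n a := by
  let B : ∀ l : V, (v ⟶ l) → Prop := fun _ _ => True
  have := Fintype.ofFinite (ArrowsFrom B)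
  let e := BoundQuiverAlgebra.ofPath I (Quiver.Path.nil : Quiver.Path v v)
  have he : e * e = e := ofPath_nil_mul_ofPath _
  have hf := toSimpleModule_surjective hI.admissible v
  let b : ArrowsFrom B → BoundQuiverAlgebra I := fun i => BoundQuiverAlgebra.ofPath I i.2.1.toPath
  have hb : ∀ i, e * b i = b i := fun i => ofPath_nil_mul_ofPath _
  have hfb : ∀ i, toSimpleModule hI.admissible v ⟨b i, b i, hb i⟩ = 0 := by
    intro i
    change (PathAlgebra.ofPath i.2.1.toPath : PathAlgebra k V) v v Quiver.Path.nil = 0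
    by_contra h
    have h₁ := congrArg (fun p => p.2.2.length) (ofPath_apply_ne_zero h)
    exact zero_ne_one h₁
  have hker : ∀ y, toSimpleModule hI.admissible v y = 0 →
      (y : BoundQuiverAlgebra I) ∈ ⨆ i, principalRightIdeal (b i) := by
    intro y hy
    obtain ⟨z, hz⟩ := I.ringCon.mk'_surjective (y : BoundQuiverAlgebra I)
    rw [← (mem_principalRightIdeal_iff_of_idempotent he).1 y.2, ← hz]
    refine mk'_mem_iSup_principalRightIdeal B z fun m p hp => Or.inr ?_
    have hy' : vertexCharacter hI.admissible v (y : BoundQuiverAlgebra I) = 0 := hy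
    rw [← hz, vertexCharacter_mk'] at hy'
    have hlen : p.length ≠ 0 := by
      intro h0
      obtain rfl := Quiver.Path.eq_of_length_zero p h0
      obtain rfl := Quiver.Path.eq_nil_of_length_zero p h0
      exact hp hy'
    obtain ⟨l, c, q, rfl, -⟩ := (Quiver.Path.length_ne_zero_iff_eq_comp p).1 hlen
    exact ⟨l, c, q, rfl, trivial⟩
  cases n with
  | zero =>
    refine (hasProjectiveDimensionLT_one_iff_isEmpty he hf b hb hfb hker ?_).trans ?_
    · intro y hy i
      obtain ⟨z, hz⟩ := I.ringCon.mk'_surjective (y : BoundQuiverAlgebra I)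
      rw [← hz]
      refine mk'_mul_ofPath_ne_zero hI.admissible z ?_ _
      have hy' : vertexCharacter hI.admissible v (y : BoundQuiverAlgebra I) =
        vertexCharacter hI.admissible v e := hy
      rwa [← hz, vertexCharacter_mk', vertexCharacter_ofPath_nil] at hy'
    · exact ⟨fun h j a _ => h.elim ⟨j, a, trivial⟩, fun h => ⟨fun i => h i.1 i.2.1 trivial⟩⟩
  | succ n =>
    refine (hasProjectiveDimensionLT_add_two_iff_principalRightIdeal he hf b hb hfb hker
      (ofPath_mul_eq_zero_of_sum_eq_zero hI.generated B) n).trans ?_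
    simp only [b, hasProjectiveDimensionLT_principalRightIdeal_arrow hI n]
    exact ⟨fun h j a => h ⟨j, a, trivial⟩, fun h i => h i.1 i.2.1⟩

end AlmostGentleAlgebra

end

theorem theorem3p8 {k : Type u} [Field k] {V : Type u} [Fintype V] [DecidableEq V]
    [Quiver.{u} V] [∀ i j : V, Finite (i ⟶ j)]
    (I : TwoSidedIdeal (PathAlgebra k V)) (hI : IsAlmostGentle I) (v : V) :
    projectiveDimension (simpleModule hI.admissible v) =
      ((⨆ F ∈ forbiddenPaths I v, (F.2.length : ℕ∞) : ℕ∞) : WithBot ℕ∞) := by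
  -- The value `⊥` is reserved for the zero module, and the right-hand side never takes it.
  have hne : projectiveDimension (simpleModule hI.admissible v) ≠ ⊥ := by
    rw [Ne, projectiveDimension_eq_bot_iff, ModuleCat.isZero_iff_subsingleton,
      not_subsingleton_iff_nontrivial]
    exact inferInstanceAs (Nontrivial k)
  -- Both sides have the same upper bounds; only the finite bounds `n` carry content.
  refine eq_of_forall_ge_iff fun d => ?_
  induction d with
  | bot => simp [hne]
  | coe d =>
    induction d with
    | top => simp
    | coe n =>
      rw [WithBot.coe_le_coe, iSup₂_le_iff]
      simp only [Nat.cast_le]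
      rw [forall_forbiddenPaths_length_le_iff]
      exact (projectiveDimension_le_iff _ n).trans
        (hasProjectiveDimensionLT_simpleModule hI v n)
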